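/- **Theorem (flat Polyak–Łojasiewicz inequality along the flow).** Let $\mathcal P(\mathbb R^d)$ be the space of Borel probability measures on $\mathbb R^d$ with the topology of weak convergence, let $\sigma>0$, let $U:\mathbb R^d\to\mathbb R$ be measurable with $\int e^{-U(x)}\,dx<\infty$, and let $\pi(dx)=\pi(x)\,dx$ with $\pi(x)=e^{-U(x)}/\int e^{-U(y)}\,dy$. For $F:\mathcal P(\mathbb R^d)\to\mathbb R$ put $$V^\sigma(m)=F(m)+\frac{\sigma^2}{2}\,\mathrm{KL}(m|\pi)\in(-\infty,\infty].$$ A *flat derivative* of $G:\mathcal P(\mathbb R^d)\to\mathbb R$ is a function $\frac{\delta G}{\delta m}:\mathcal P(\mathbb R^d)\times\mathbb R^d\to\mathbb R$ that is continuous in $m$ for each $x$, measurable and bounded in $x$ for each $m$, and satisfies, for all $m,m'\in\mathcal P(\mathbb R^d)$, $$G(m')-G(m)=\int_0^1\int_{\mathbb R^d}\frac{\delta G}{\delta m}(m+\lambda(m'-m),x)\,(m'-m)(dx)\,d\lambda .$$ *Assumption 1.* $F$ has a flat derivative $\frac{\delta F}{\delta m}$, normalized by $\int\frac{\delta F}{\delta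 m}(m,x)\,m(dx)=0$ for all $m$, and for each $x$ the map $m\mapsto\frac{\delta F}{\delta m}(m,x)$ has a flat derivative $\frac{\delta^2F}{\delta m^2}(m,x,\cdot)$. Moreover $F(m)-F(m')\le\int\frac{\delta F}{\delta m}(m,x)\,(m-m')(dx)$ for all $m,m'$, and there are constants $C,C_2>0$ with $|\frac{\delta F}{\delta m}(m,x)|\le C$ and $|\frac{\delta^2F}{\delta m^2}(m,x,y)|\le C_2$ for all $m,x,y$. *Assumption 2.* $m_0\in\mathcal P(\mathbb R^d)$ has a density $m_0(x)$, and there are $r>0$ and $R>1$ with $r\le m_0(x)/\pi(x)\le R$ for all $x\in\mathbb R^d$. Let $(m_t)_{t\ge0}$ be a flow of probability measures starting from $m_0$, with densities $m_t(x)$ and $\mathrm{KL}(m_t|\pi)<\infty$, that solves the birth–death equation: for all $t\ge0$ and $x\in\mathbb R^d$ (with the one-sided derivative at $t=0$), $$\partial_t m_t(x)=-a(m_t,x)\,m_t(x),\qquad a(m,x)=\frac{\delta F}{\delta m}(m,x)+\frac{\sigma^2}{2}\log\frac{m(x)}{\pi(x)}-\frac{\sigma^2}{2}\mathrm{KL}(m|\pi).$$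 Then $V^\sigma$ has a minimizer over $\mathcal P(\mathbb R^d)$. Every minimizer $m^{\sigma,*}$ has $V^\sigma(m^{\sigma,*})<\infty$ and has the density $$m^{\sigma,*}(x)=\frac1Z\exp\Big(-\frac{2}{\sigma^2}\frac{\delta F}{\delta m}(m^{\sigma,*},x)-U(x)\Big),$$ where $Z$ is the normalizing constant. There are constants $\bar r_1>0$ and $\bar R_1>1$ such that $$\bar r_1\le\frac{m_t(x)}{m^{\sigma,*}(x)}\le\bar R_1\qquad\text{for all }t\ge0,\ x\in\mathbb R^d, \tag{1}$$ and for all constants $\bar r_1>0$ and $\bar R_1$ satisfying (1) and all $t\ge0$ one has $V^\sigma(m_t)<\infty$, $a(m_t,\cdot)\in L^2(m_t)$ and $$V^\sigma(m_t)-V^\sigma(m^{\sigma,*})\le\frac{4\bar R_1}{\sigma^2\,\bar r_1}\,\|a(m_t,\cdot)\|^2_{L^2(m_t)} .$$ -/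

import Mathlib

open MeasureTheory Set
open scoped ENNReal

noncomputable section

namespace FisherRao

/-- The Euclidean space `ℝ^d`. -/
abbrev E (d : ℕ) : Type := EuclideanSpace ℝ (Fin d)

/-- The space of Borel probability measures on `ℝ^d`, with the topology of weak convergence. -/
abbrev P (d : ℕ) : Type := ProbabilityMeasure (E d)

variable {d : ℕ}

/-- The measure `m + l (m' - m) = (1 - l) m + l m'`, for `l ∈ [0, 1]`. -/
def mix (m m' : P d) (l : unitInterval) : P d :=
  ⟨ENNReal.ofReal (1 - (l : ℝ)) • (m : Measure (E d)) +
      ENNReal.ofReal (l : ℝ) • (m' : Measure (E d)), ⟨by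
    have h0 : (0 : ℝ) ≤ l := l.2.1
    have h1 : (0 : ℝ) ≤ 1 - l := sub_nonneg.2 l.2.2
    simp only [Measure.add_apply, Measure.smul_apply, measure_univ, smul_eq_mul, mul_one]
    rw [← ENNReal.ofReal_add h1 h0]
    simp⟩⟩

/-- The integral `∫ f d(m' - m)` against a difference of two probability measures. -/
def integralDiff (f : E d → ℝ) (m' m : P d) : ℝ :=
  (∫ x, f x ∂(m' : Measure (E d))) - ∫ x, f x ∂(m : Measure (E d))

/-- `D` is a flat (linear functional) derivative of `F : P(ℝ^d) → ℝ`. The integral over `[0, 1]`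
is written with the projection of `ℝ` to `[0, 1]`, which is the identity there. -/
structure IsFlatDerivative (F : P d → ℝ) (D : P d → E d → ℝ) : Prop where
  measurable : ∀ m, Measurable (D m)
  continuous : ∀ x, Continuous fun m => D m x
  bounded : ∀ m, ∃ C > 0, ∀ x, |D m x| ≤ C
  intervalIntegrable : ∀ m m' : P d, IntervalIntegrable
    (fun l : ℝ => integralDiff (D (mix m m' (projIcc 0 1 zero_le_one l))) m' m) volume 0 1
  sub_eq : ∀ m m' : P d, F m' - F m =
    ∫ l in (0 : ℝ)..1, integralDiff (D (mix m m' (projIcc 0 1 zero_le_one l))) m' m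

/-- The normalizing convention `∫ D(m, x) m(dx) = 0`. -/
def IsNormalized (D : P d → E d → ℝ) : Prop :=
  ∀ m : P d, ∫ x, D m x ∂(m : Measure (E d)) = 0

/-- The assumption on the energy: `F` has first and second order flat derivatives `dF` and `d2F`,
is convex, and both derivatives are uniformly bounded. -/
structure EnergyAssumption (F : P d → ℝ) (dF : P d → E d → ℝ)
    (d2F : P d → E d → E d → ℝ) : Prop where
  first : IsFlatDerivative F dF
  normalized : IsNormalized dF
  second : ∀ x, IsFlatDerivative (fun m => dF m x) (fun m => d2F m x)
  convex : ∀ m m' : P d, F m - F m' ≤ integralDiff (dF m) m m'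
  first_bounded : ∃ C > 0, ∀ m x, |dF m x| ≤ C
  second_bounded : ∃ C₂ > 0, ∀ m x y, |d2F m x y| ≤ C₂

/-- The function `p` is (everywhere, as a chosen version) the Lebesgue density of `μ`. -/
structure HasDensity (μ : P d) (p : E d → ℝ) : Prop where
  measurable : Measurable p
  nonneg : ∀ x, 0 ≤ p x
  eq : (μ : Measure (E d)) = volume.withDensity fun x => ENNReal.ofReal (p x)

/-- The density `π(x) = e^{-U(x)} / ∫ e^{-U}` of the reference measure. -/
def refDensity (U : E d → ℝ) (x : E d) : ℝ :=
  Real.exp (-U x) / ∫ y, Real.exp (-U y)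

/-- The reference measure `π(dx) ∝ e^{-U(x)} dx`. -/
def refMeasure (U : E d → ℝ) : Measure (E d) :=
  volume.withDensity fun x => ENNReal.ofReal (refDensity U x)

/-- The assumption on the initial measure `m₀`, with density `ρ₀`: the ratio `ρ₀ / π` is bounded
below by some `r > 0` and above by some `R > 1`. -/
structure InitialAssumption (U : E d → ℝ) (m₀ : P d) (ρ₀ : E d → ℝ) : Prop where
  density : HasDensity m₀ ρ₀
  lower : ∃ r > 0, ∀ x, r ≤ ρ₀ x / refDensity U x
  upper : ∃ R > 1, ∀ x, ρ₀ x / refDensity U x ≤ R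

/-- The regularised energy `V^σ(m) = F(m) + (σ² / 2) KL(m | π)`, with values in `(-∞, ∞]`. -/
def energy (F : P d → ℝ) (U : E d → ℝ) (σ : ℝ) (m : P d) : EReal :=
  ((F m : ℝ) : EReal) + ((σ ^ 2 / 2 : ℝ) : EReal) *
    ((InformationTheory.klDiv (m : Measure (E d)) (refMeasure U) : ℝ≥0∞) : EReal)

/-- `μ` minimizes `V^σ` over all probability measures. -/
def IsMinimizer (F : P d → ℝ) (U : E d → ℝ) (σ : ℝ) (μ : P d) : Prop :=
  ∀ m : P d, energy F U σ μ ≤ energy F U σ m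

/-- The unnormalized density `exp(-(2 / σ²) (δF/δm)(μ, x) - U(x))`. -/
def gibbsWeight (dF : P d → E d → ℝ) (U : E d → ℝ) (σ : ℝ) (μ : P d) (x : E d) : ℝ :=
  Real.exp (-(2 / σ ^ 2) * dF μ x - U x)

/-- The density `Z⁻¹ exp(-(2 / σ²) (δF/δm)(μ, x) - U(x))`, with `Z` the normalizing constant. -/
def gibbsDensity (dF : P d → E d → ℝ) (U : E d → ℝ) (σ : ℝ) (μ : P d) (x : E d) : ℝ :=
  gibbsWeight dF U σ μ x / ∫ y, gibbsWeight dF U σ μ y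

/-- `a(m, x) = (δF/δm)(m, x) + (σ² / 2) log (m(x) / π(x)) - (σ² / 2) KL(m | π)`, where `p` is
the density of `m`. -/
def rate (dF : P d → E d → ℝ) (U : E d → ℝ) (σ : ℝ) (m : P d) (p : E d → ℝ) (x : E d) : ℝ :=
  dF m x + σ ^ 2 / 2 * Real.log (p x / refDensity U x) -
    σ ^ 2 / 2 * (InformationTheory.klDiv (m : Measure (E d)) (refMeasure U)).toReal

/-- `(m t)`, `t ≥ 0`, with densities `ρ t`, solves the birth-death equation
`∂_t m_t(x) = - a(m_t, x) m_t(x)` and starts from `m₀` with density `ρ₀`; at `t = 0` the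
derivative is one-sided. Finiteness of the KL-divergence is what makes `a(m_t, ·)` defined. -/
structure IsBirthDeathFlow (dF : P d → E d → ℝ) (U : E d → ℝ) (σ : ℝ) (m₀ : P d)
    (ρ₀ : E d → ℝ) (m : ℝ → P d) (ρ : ℝ → E d → ℝ) : Prop where
  init_measure : m 0 = m₀
  init_density : ρ 0 = ρ₀
  density : ∀ t, 0 ≤ t → HasDensity (m t) (ρ t)
  kl_ne_top : ∀ t, 0 ≤ t →
    InformationTheory.klDiv (m t : Measure (E d)) (refMeasure U) ≠ ⊤
  deriv : ∀ t, 0 ≤ t → ∀ x, HasDerivWithinAt (fun s => ρ s x)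
    (-(rate dF U σ (m t) (ρ t) x) * ρ t x) (Ici 0) t

end FisherRao

end

/-!
The proof works with densities relative to the reference measure `π` (`HasRelDensity`), in terms of
which `KL(m | π) = ∫ klFun(p) dπ`.

*Existence of a minimizer.* The pointwise inequality `klFun_midpoint_add_sq_le` makes the
regularised energy strongly convex at midpoints for the Hellinger distance
(`EnergyAssumption.exists_realEnergy_midpoint`). Densities along a minimizing sequence are
therefore Cauchy in `L¹(π)`. The limit is a minimizer: the divergence is lower semicontinuous by
Fatou's lemma, and convexity of `F` with the bound on `δF/δm` gives the same for `F`
(`EnergyAssumption.exists_isMinimizer`). No compactness argument is needed.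

*Gibbs form.* Comparing a minimizer `m` with mixtures `m + l (μ - m)` as `l → 0` gives the first
order condition `IsMinimizer.first_order`. For `μ` the tilt of `π` by `-(2 / σ²) δF/δm(m, ·)`, the
Gibbs variational identity turns it into `KL(m | μ) ≤ 0`, so `m = μ` (`IsMinimizer.eq_tilted`).

*Uniform bounds.* A barrier argument keeps `m_t(x)` positive. In the equation for
`log (m_t / π)(x) - log (m_t / π)(y)` the term `KL(m_t | π)`, on which no bound uniform in time is
assumed, cancels, and what remains is a damped equation with a bounded source; the oscillation of
`log (m_t / π)` is thus bounded uniformly in time. As `m_t / π` has mean `1`, its logarithm takes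
a value `≤ 0` and a value `≥ 0`, so it is bounded by its oscillation
(`IsBirthDeathFlow.exists_ratio_bounds`).

*The inequality.* With `p`, `q` the densities of `m_t` and of the minimizer, convexity of `F` bounds
the energy gap by `∫ (a (p - q) - (σ² / 2) (q log (q / p) - q + p)) dπ`. The relative entropy
dominates `(√p - √q)²`, so Young's inequality absorbs the linear term pointwise
(`mul_sub_sub_entropy_le`). This yields the constant `2 / (σ² r)`, which is at most `4 R / (σ² r)`
since `1 ≤ R`.
-/

namespace FisherRao

open InformationTheory Filter Topology

/-! ### Pointwise entropy inequalities -/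

theorem sq_sqrt_sub_one_le_klFun {x : ℝ} (hx : 0 ≤ x) : (√x - 1) ^ 2 ≤ klFun x := by
  rcases hx.eq_or_lt with rfl | hx
  · simp [klFun_zero]
  have hs : 0 < √x := Real.sqrt_pos.2 hx
  have h1 : 1 - (√x)⁻¹ ≤ Real.log √x := Real.one_sub_inv_le_log_of_pos hs
  have h2 : Real.log √x = Real.log x / 2 := Real.log_sqrt hx.le
  have h3 : √x * √x = x := Real.mul_self_sqrt hx.le
  have h4 : x * (1 - (√x)⁻¹) = x - √x := by
    field_simp
    nlinarith
  have h5 := mul_le_mul_of_nonneg_left h1 hx.le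
  rw [klFun_apply]
  nlinarith

/-- The pointwise form of the bound of the squared Hellinger distance by the divergence. -/
theorem sq_sqrt_sub_sqrt_le {a b : ℝ} (ha : 0 ≤ a) (hb : 0 < b) :
    (√a - √b) ^ 2 ≤ a * Real.log a - a * Real.log b - a + b := by
  have h := sq_sqrt_sub_one_le_klFun (div_nonneg ha hb.le)
  have hb' : 0 < √b := Real.sqrt_pos.2 hb
  have e1 : b * (√(a / b) - 1) ^ 2 = (√a - √b) ^ 2 := by
    rw [Real.sqrt_div ha]
    nth_rewrite 1 [← Real.sq_sqrt hb.le]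
    field_simp
  have e2 : b * klFun (a / b) = a * Real.log a - a * Real.log b - a + b := by
    rcases ha.eq_or_lt with rfl | ha
    · simp [klFun_zero]
    rw [klFun_apply, Real.log_div ha.ne' hb.ne']
    field_simp
    ring
  rw [← e1, ← e2]
  exact mul_le_mul_of_nonneg_left h hb.le

/-- Quantitative strict convexity of `klFun` at midpoints. -/
theorem klFun_midpoint_add_sq_le {a b : ℝ} (ha : 0 ≤ a) (hb : 0 ≤ b) :
    klFun ((a + b) / 2) + (√a - √b) ^ 2 / 4 ≤ klFun a / 2 + klFun b / 2 := by
  rcases (add_nonneg ha hb).eq_or_lt with h | h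
  · obtain rfl : a = 0 := by linarith
    obtain rfl : b = 0 := by linarith
    simp [klFun_zero]; norm_num
  have hm : 0 < (a + b) / 2 := by linarith
  have h1 := sq_sqrt_sub_sqrt_le ha hm
  have h2 := sq_sqrt_sub_sqrt_le hb hm
  simp only [klFun_apply]
  nlinarith [sq_nonneg (√a + √b - 2 * √((a + b) / 2))]

/-- Integrated, and with `δ` of the order of the Hellinger distance, this bounds the `L¹`-distance
of two densities by a multiple of their Hellinger distance. -/
theorem abs_sub_le_sq_sqrt_sub {a b δ : ℝ} (ha : 0 ≤ a) (hb : 0 ≤ b) (hδ : 0 < δ) :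
    |a - b| ≤ (√a - √b) ^ 2 / (2 * δ) + δ * (a + b) := by
  have e : a - b = (√a - √b) * (√a + √b) := by
    nlinarith [Real.sq_sqrt ha, Real.sq_sqrt hb]
  have hs : 0 ≤ √a + √b := by positivity
  rw [e, abs_mul, abs_of_nonneg hs]
  have h1 : (√a + √b) ^ 2 ≤ 2 * (a + b) := by
    nlinarith [Real.sq_sqrt ha, Real.sq_sqrt hb, sq_nonneg (√a - √b)]
  have h2 : |√a - √b| * (√a + √b) ≤ (√a - √b) ^ 2 / (2 * δ) + δ / 2 * (√a + √b) ^ 2 := by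
    rw [← sub_nonneg]
    have : (√a - √b) ^ 2 / (2 * δ) + δ / 2 * (√a + √b) ^ 2 - |√a - √b| * (√a + √b) =
        (|√a - √b| - δ * (√a + √b)) ^ 2 / (2 * δ) := by
      rw [← sq_abs (√a - √b)]
      field_simp
      ring
    rw [this]
    positivity
  nlinarith

/-! ### Densities relative to a reference measure -/

section RelDensity

variable {α : Type*} [MeasurableSpace α] {π μ : Measure α} {p : α → ℝ}

/-- The function `p` is an everywhere nonnegative version of the density of `μ` relative to
`π`. -/
structure HasRelDensity (π μ : Measure α) (p : α → ℝ) : Prop where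
  measurable : Measurable p
  nonneg : ∀ x, 0 ≤ p x
  eq : μ = π.withDensity fun x => ENNReal.ofReal (p x)

theorem HasRelDensity.absolutelyContinuous (h : HasRelDensity π μ p) : μ ≪ π :=
  h.eq ▸ withDensity_absolutelyContinuous _ _

theorem HasRelDensity.integral_eq (h : HasRelDensity π μ p) (f : α → ℝ) :
    ∫ x, f x ∂μ = ∫ x, p x * f x ∂π := by
  rw [h.eq, integral_withDensity_eq_integral_toReal_smul h.measurable.ennreal_ofReal (by simp)]
  simp [ENNReal.toReal_ofReal (h.nonneg _)]

theorem HasRelDensity.integrable_iff (h : HasRelDensity π μ p) {f : α → ℝ} :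
    Integrable f μ ↔ Integrable (fun x => p x * f x) π := by
  rw [h.eq, integrable_withDensity_iff_integrable_smul' h.measurable.ennreal_ofReal (by simp)]
  simp [ENNReal.toReal_ofReal (h.nonneg _)]

theorem HasRelDensity.integrable [IsProbabilityMeasure μ] (h : HasRelDensity π μ p) :
    Integrable p π := by
  simpa using h.integrable_iff.1 (integrable_const (1 : ℝ))

theorem HasRelDensity.integral [IsProbabilityMeasure μ] (h : HasRelDensity π μ p) :
    ∫ x, p x ∂π = 1 := by
  simpa using (h.integral_eq fun _ => 1).symm

theorem HasRelDensity.rnDeriv_ae [SigmaFinite π] (h : HasRelDensity π μ p) :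
    ∀ᵐ x ∂π, (μ.rnDeriv π x).toReal = p x := by
  have := Measure.rnDeriv_withDensity π h.measurable.ennreal_ofReal
  rw [← h.eq] at this
  filter_upwards [this] with x hx
  rw [hx, ENNReal.toReal_ofReal (h.nonneg x)]

theorem hasRelDensity_rnDeriv [SigmaFinite π] [SigmaFinite μ] (h : μ ≪ π) :
    HasRelDensity π μ fun x => (μ.rnDeriv π x).toReal where
  measurable := (Measure.measurable_rnDeriv μ π).ennreal_toReal
  nonneg _ := ENNReal.toReal_nonneg
  eq := by
    conv_lhs => rw [← Measure.withDensity_rnDeriv_eq μ π h]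
    refine withDensity_congr_ae ?_
    filter_upwards [Measure.rnDeriv_lt_top μ π] with x hx
    rw [ENNReal.ofReal_toReal hx.ne]

/-- Probability densities relative to `π` which are Cauchy in `L¹(π)`, at a summable rate, converge
almost everywhere and in `L¹(π)` to a probability density. -/
theorem exists_hasRelDensity_of_cauchy {μs : ℕ → Measure α} {ps : ℕ → α → ℝ}
    [∀ n, IsProbabilityMeasure (μs n)] (h : ∀ n, HasRelDensity π (μs n) (ps n)) {b : ℕ → ℝ}
    (hb : Summable b)
    (hcau : ∀ N n k, N ≤ n → N ≤ k → ∫ x, |ps n x - ps k x| ∂π < b N) :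
    ∃ (μ : Measure α) (p : α → ℝ), IsProbabilityMeasure μ ∧ HasRelDensity π μ p ∧
      (∀ᵐ x ∂π, Tendsto (fun n => ps n x) atTop (𝓝 (p x))) ∧
      Tendsto (fun n => ∫ x, |ps n x - p x| ∂π) atTop (𝓝 0) := by
  have hmeas : ∀ n, AEStronglyMeasurable (ps n) π := fun n =>
    (h n).measurable.aestronglyMeasurable
  have hnorm : ∀ {f : α → ℝ}, Integrable f π →
      eLpNorm f 1 π = ENNReal.ofReal (∫ x, |f x| ∂π) := by
    intro f hf
    rw [eLpNorm_one_eq_lintegral_enorm, ← ofReal_integral_norm_eq_lintegral_enorm hf]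
    rfl
  have hB : ∑' n, ENNReal.ofReal (b n) ≠ ∞ := hb.tsum_ofReal_ne_top
  have hC : ∀ N n k, N ≤ n → N ≤ k → eLpNorm (ps n - ps k) 1 π < ENNReal.ofReal (b N) := by
    intro N n k hn hk
    rw [hnorm ((h n).integrable.sub (h k).integrable)]
    have := hcau N n k hn hk
    refine (ENNReal.ofReal_lt_ofReal_iff (lt_of_le_of_lt ?_ this)).2 this
    exact integral_nonneg fun x => abs_nonneg _
  obtain ⟨g, hg, hlim⟩ := exists_stronglyMeasurable_limit_of_tendsto_ae hmeas
    (Lp.ae_tendsto_of_cauchy_eLpNorm hmeas le_rfl hB hC)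
  have hg0 : ∀ᵐ x ∂π, 0 ≤ g x := by
    filter_upwards [hlim] with x hx
    exact ge_of_tendsto' hx fun n => (h n).nonneg x
  have hpg : ∀ᵐ x ∂π, g x = max (g x) 0 := by
    filter_upwards [hg0] with x hx
    rw [max_eq_left hx]
  have hL := Lp.cauchy_tendsto_of_tendsto hmeas g hB hC hlim
  have hgi : Integrable g π := memLp_one_iff_integrable.1
    (Lp.memLp_of_cauchy_tendsto le_rfl (fun n => memLp_one_iff_integrable.2 (h n).integrable) g
      hg.aestronglyMeasurable hL)
  have hL' : Tendsto (fun n => ∫ x, |ps n x - g x| ∂π) atTop (𝓝 0) := by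
    have := (ENNReal.tendsto_toReal ENNReal.zero_ne_top).comp hL
    refine this.congr fun n => ?_
    simp only [Function.comp]
    rw [hnorm ((h n).integrable.sub hgi), ENNReal.toReal_ofReal
      (integral_nonneg fun x => abs_nonneg _)]
    rfl
  have hint : ∫ x, g x ∂π = 1 := by
    have h0 : Tendsto (fun n => ∫ x, ps n x ∂π) atTop (𝓝 (∫ x, g x ∂π)) := by
      rw [tendsto_iff_norm_sub_tendsto_zero]
      refine squeeze_zero (fun _ => norm_nonneg _) (fun n => ?_) hL'
      rw [← integral_sub (h n).integrable hgi]
      exact norm_integral_le_integral_norm _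
    simp only [(h _).integral] at h0
    exact tendsto_nhds_unique h0 tendsto_const_nhds
  refine ⟨π.withDensity fun x => ENNReal.ofReal (max (g x) 0), fun x => max (g x) 0, ⟨?_⟩,
    ⟨hg.measurable.max measurable_const, fun x => le_max_right _ _, rfl⟩, ?_, ?_⟩
  · rw [withDensity_apply _ MeasurableSet.univ, Measure.restrict_univ,
      ← ofReal_integral_eq_lintegral_ofReal (hgi.congr hpg)
        (ae_of_all _ fun x => le_max_right _ _), ← integral_congr_ae hpg, hint,
      ENNReal.ofReal_one]
  · filter_upwards [hlim, hpg] with x hx hx'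
    rwa [← hx']
  · refine hL'.congr fun n => integral_congr_ae ?_
    filter_upwards [hpg] with x hx
    rw [← hx]

variable [IsProbabilityMeasure π] [IsProbabilityMeasure μ]

theorem HasRelDensity.klDiv_eq (h : HasRelDensity π μ p) :
    klDiv μ π = ∫⁻ x, ENNReal.ofReal (klFun (p x)) ∂π := by
  rw [klDiv_eq_lintegral_klFun_of_ac h.absolutelyContinuous]
  refine lintegral_congr_ae ?_
  filter_upwards [h.rnDeriv_ae] with x hx
  rw [hx]

theorem HasRelDensity.toReal_klDiv_eq (h : HasRelDensity π μ p) :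
    (klDiv μ π).toReal = ∫ x, klFun (p x) ∂π := by
  rw [toReal_klDiv_eq_integral_klFun h.absolutelyContinuous]
  refine integral_congr_ae ?_
  filter_upwards [h.rnDeriv_ae] with x hx
  rw [hx]

theorem HasRelDensity.klDiv_ne_top_iff (h : HasRelDensity π μ p) :
    klDiv μ π ≠ ∞ ↔ Integrable (fun x => klFun (p x)) π := by
  rw [h.klDiv_eq]
  exact lintegral_ofReal_ne_top_iff_integrable
    (measurable_klFun.comp h.measurable).aestronglyMeasurable
    (ae_of_all _ fun x => klFun_nonneg (h.nonneg x))

end RelDensity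

/-! ### The reference measure and mixtures -/

section Reference

variable {d : ℕ} {U : E d → ℝ}

theorem integral_exp_neg_pos (hUint : Integrable (fun x => Real.exp (-U x))) :
    0 < ∫ x, Real.exp (-U x) :=
  integral_exp_pos hUint

theorem refDensity_pos (hUint : Integrable (fun x => Real.exp (-U x))) (x : E d) :
    0 < refDensity U x :=
  div_pos (Real.exp_pos _) (integral_exp_neg_pos hUint)

theorem measurable_refDensity (hU : Measurable U) : Measurable (refDensity U) :=
  (hU.neg.exp).div_const _

theorem hasRelDensity_refMeasure (hU : Measurable U)
    (hUint : Integrable (fun x => Real.exp (-U x))) :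
    HasRelDensity volume (refMeasure U) (refDensity U) where
  measurable := measurable_refDensity hU
  nonneg x := (refDensity_pos hUint x).le
  eq := rfl

theorem isProbabilityMeasure_refMeasure (hUint : Integrable (fun x => Real.exp (-U x))) :
    IsProbabilityMeasure (refMeasure U) := by
  constructor
  rw [refMeasure, withDensity_apply _ MeasurableSet.univ, Measure.restrict_univ,
    ← ofReal_integral_eq_lintegral_ofReal (f := refDensity U) (hUint.div_const _)
      (ae_of_all _ fun x => (refDensity_pos hUint x).le)]
  simp only [refDensity]
  rw [integral_div, div_self (integral_exp_neg_pos hUint).ne', ENNReal.ofReal_one]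

/-- A Lebesgue density is `π` times a density relative to the reference measure. -/
theorem HasDensity.hasRelDensity (hU : Measurable U)
    (hUint : Integrable (fun x => Real.exp (-U x))) {μ : P d} {ρ : E d → ℝ}
    (h : HasDensity μ ρ) :
    HasRelDensity (refMeasure U) (μ : Measure (E d)) (fun x => ρ x / refDensity U x) where
  measurable := h.measurable.div (measurable_refDensity hU)
  nonneg x := div_nonneg (h.nonneg x) (refDensity_pos hUint x).le
  eq := by
    have hm : Measurable fun x => ENNReal.ofReal (ρ x / refDensity U x) :=
      (h.measurable.div (measurable_refDensity hU)).ennreal_ofReal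
    rw [refMeasure, ← withDensity_mul _ (measurable_refDensity hU).ennreal_ofReal hm, h.eq]
    congr 1
    ext x
    have hp := refDensity_pos hUint x
    simp only [Pi.mul_apply]
    rw [← ENNReal.ofReal_mul hp.le, mul_div_cancel₀ _ hp.ne']

end Reference

section Mix

variable {d : ℕ} {π : Measure (E d)} {m m' : P d} {p q : E d → ℝ}

theorem hasRelDensity_mix (hm : HasRelDensity π m p) (hm' : HasRelDensity π m' q)
    (l : unitInterval) :
    HasRelDensity π (mix m m' l : P d) (fun x => (1 - (l : ℝ)) * p x + l * q x) where
  measurable := (hm.measurable.const_mul _).add (hm'.measurable.const_mul _)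
  nonneg x := add_nonneg (mul_nonneg (sub_nonneg.2 l.2.2) (hm.nonneg x))
    (mul_nonneg l.2.1 (hm'.nonneg x))
  eq := by
    have h0 : (0 : ℝ) ≤ l := l.2.1
    have h1 : (0 : ℝ) ≤ 1 - l := sub_nonneg.2 l.2.2
    change ENNReal.ofReal (1 - (l : ℝ)) • (m : Measure (E d)) +
      ENNReal.ofReal (l : ℝ) • (m' : Measure (E d)) = _
    rw [hm.eq, hm'.eq, ← withDensity_smul _ hm.measurable.ennreal_ofReal,
      ← withDensity_smul _ hm'.measurable.ennreal_ofReal,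
      ← withDensity_add_left (hm.measurable.ennreal_ofReal.const_smul _)]
    congr 1
    ext x
    simp only [Pi.add_apply, Pi.smul_apply, smul_eq_mul]
    rw [ENNReal.ofReal_add (mul_nonneg h1 (hm.nonneg x)) (mul_nonneg h0 (hm'.nonneg x)),
      ENNReal.ofReal_mul h1, ENNReal.ofReal_mul h0]

theorem integral_mix {f : E d → ℝ} (hf : Measurable f) {C : ℝ} (hC : ∀ x, |f x| ≤ C)
    (l : unitInterval) :
    ∫ x, f x ∂(mix m m' l : Measure (E d)) =
      (1 - (l : ℝ)) * ∫ x, f x ∂(m : Measure (E d)) + l * ∫ x, f x ∂(m' : Measure (E d)) := by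
  have h0 : (0 : ℝ) ≤ l := l.2.1
  have h1 : (0 : ℝ) ≤ 1 - l := sub_nonneg.2 l.2.2
  have hi : ∀ μ : P d, Integrable f (μ : Measure (E d)) := fun μ =>
    Integrable.of_bound hf.aestronglyMeasurable C (ae_of_all _ hC)
  change ∫ x, f x ∂(ENNReal.ofReal (1 - (l : ℝ)) • (m : Measure (E d)) +
      ENNReal.ofReal (l : ℝ) • (m' : Measure (E d))) = _
  rw [integral_add_measure ((hi m).smul_measure ENNReal.ofReal_ne_top)
    ((hi m').smul_measure ENNReal.ofReal_ne_top), integral_smul_measure, integral_smul_measure,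
    ENNReal.toReal_ofReal h0, ENNReal.toReal_ofReal h1]
  simp

theorem integralDiff_mix {f : E d → ℝ} (hf : Measurable f) {C : ℝ} (hC : ∀ x, |f x| ≤ C)
    (l : unitInterval) :
    integralDiff f (mix m m' l) m = l * integralDiff f m' m := by
  rw [integralDiff, integral_mix hf hC, integralDiff]
  ring

theorem tendsto_mix {ι : Type*} {L : Filter ι} {l : ι → unitInterval}
    (hl : Tendsto (fun i => (l i : ℝ)) L (𝓝 0)) :
    Tendsto (fun i => mix m m' (l i)) L (𝓝 m) := by
  rw [ProbabilityMeasure.tendsto_iff_forall_integral_tendsto]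
  intro f
  have : ∀ i, ∫ x, f x ∂(mix m m' (l i) : Measure (E d)) =
      (1 - (l i : ℝ)) * ∫ x, f x ∂(m : Measure (E d)) +
        (l i : ℝ) * ∫ x, f x ∂(m' : Measure (E d)) := fun i =>
    integral_mix f.continuous.measurable (C := ‖f‖) (fun x => f.norm_coe_le_norm x) (l i)
  simp only [this]
  simpa using ((((tendsto_const_nhds (x := (1 : ℝ))).sub hl).mul_const
    (∫ x, f x ∂(m : Measure (E d))))).add (hl.mul_const (∫ x, f x ∂(m' : Measure (E d))))

end Mix

/-! ### The regularised energy and its minimizer -/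

section Energy

variable {d : ℕ} {F : P d → ℝ} {dF : P d → E d → ℝ} {d2F : P d → E d → E d → ℝ}
  {U : E d → ℝ} {σ : ℝ}

/-- The regularised energy as a real number. It agrees with `energy` where the divergence is
finite; elsewhere the divergence is replaced by `0`. -/
noncomputable def realEnergy (F : P d → ℝ) (U : E d → ℝ) (σ : ℝ) (m : P d) : ℝ :=
  F m + σ ^ 2 / 2 * (klDiv (m : Measure (E d)) (refMeasure U)).toReal

theorem energy_eq_coe {m : P d} (h : klDiv (m : Measure (E d)) (refMeasure U) ≠ ∞) :
    energy F U σ m = (realEnergy F U σ m : ℝ) := by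
  rw [energy, realEnergy, EReal.coe_add, EReal.coe_mul, EReal.coe_ennreal_toReal h]

theorem energy_eq_top (hσ : 0 < σ) {m : P d}
    (h : klDiv (m : Measure (E d)) (refMeasure U) = ∞) : energy F U σ m = ⊤ := by
  have h2 : 0 < σ ^ 2 / 2 := by positivity
  rw [energy, h, EReal.coe_ennreal_top, EReal.coe_mul_top_of_pos h2, EReal.coe_add_top]

theorem isMinimizer_iff (hσ : 0 < σ) (hUint : Integrable (fun x => Real.exp (-U x))) {m : P d} :
    IsMinimizer F U σ m ↔ klDiv (m : Measure (E d)) (refMeasure U) ≠ ∞ ∧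
      ∀ m' : P d, klDiv (m' : Measure (E d)) (refMeasure U) ≠ ∞ →
        realEnergy F U σ m ≤ realEnergy F U σ m' := by
  have := isProbabilityMeasure_refMeasure hUint
  constructor
  · intro h
    have hm : klDiv (m : Measure (E d)) (refMeasure U) ≠ ∞ := by
      intro hm
      have h0 : klDiv ((⟨refMeasure U, inferInstance⟩ : P d) : Measure (E d))
          (refMeasure U) ≠ ∞ := by simp
      have := h ⟨refMeasure U, inferInstance⟩
      rw [energy_eq_top hσ hm, energy_eq_coe h0] at this
      exact EReal.coe_ne_top _ (top_le_iff.1 this)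
    refine ⟨hm, fun m' hm' => ?_⟩
    have := h m'
    rwa [energy_eq_coe hm, energy_eq_coe hm', EReal.coe_le_coe_iff] at this
  · rintro ⟨hm, h⟩ m'
    by_cases hm' : klDiv (m' : Measure (E d)) (refMeasure U) = ∞
    · rw [energy_eq_top hσ hm']
      exact le_top
    · rw [energy_eq_coe hm, energy_eq_coe hm', EReal.coe_le_coe_iff]
      exact h m' hm'

theorem abs_integralDiff_le {C : ℝ}
    (hC : ∀ m x, |dF m x| ≤ C) (μ m m' : P d) : |integralDiff (dF μ) m m'| ≤ 2 * C := by
  have h : ∀ ν : P d, |∫ x, dF μ x ∂(ν : Measure (E d))| ≤ C := fun ν => by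
    simpa using norm_integral_le_of_norm_le_const (μ := (ν : Measure (E d))) (f := dF μ)
      (ae_of_all _ (hC μ))
  have h1 := abs_le.1 (h m)
  have h2 := abs_le.1 (h m')
  rw [integralDiff, abs_le]
  constructor <;> linarith

theorem integralDiff_eq_integral {π : Measure (E d)} {m m' : P d} {p q f : E d → ℝ}
    (hm : HasRelDensity π m p) (hm' : HasRelDensity π m' q) (hf : Measurable f) {C : ℝ}
    (hC : ∀ x, |f x| ≤ C) :
    integralDiff f m m' = ∫ x, f x * (p x - q x) ∂π := by
  have hi : ∀ μ : P d, Integrable f (μ : Measure (E d)) := fun μ =>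
    Integrable.of_bound hf.aestronglyMeasurable C (ae_of_all _ hC)
  rw [integralDiff, hm.integral_eq, hm'.integral_eq,
    ← integral_sub (hm.integrable_iff.1 (hi m)) (hm'.integrable_iff.1 (hi m'))]
  congr 1
  ext x
  ring

theorem EnergyAssumption.le_integral_abs (hF : EnergyAssumption F dF d2F) {C : ℝ}
    (hC : ∀ m x, |dF m x| ≤ C) {π : Measure (E d)} {m m' : P d} {p q : E d → ℝ}
    (hm : HasRelDensity π m p) (hm' : HasRelDensity π m' q) :
    F m - F m' ≤ C * ∫ x, |q x - p x| ∂π := by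
  refine (hF.convex m m').trans ?_
  rw [integralDiff_eq_integral hm hm' (hF.first.measurable m) (hC m), ← integral_const_mul]
  have hi := (hm.integrable.sub hm'.integrable)
  refine integral_mono (hi.bdd_mul (hF.first.measurable m).aestronglyMeasurable
    (ae_of_all _ (hC m))) ((hm'.integrable.sub hm.integrable).abs.const_mul C) fun x => ?_
  calc dF m x * (p x - q x) ≤ |dF m x| * |p x - q x| := by
        rw [← abs_mul]; exact le_abs_self _
    _ ≤ C * |q x - p x| := by
        rw [abs_sub_comm]
        exact mul_le_mul_of_nonneg_right (hC m x) (abs_nonneg _)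

theorem HasRelDensity.klDiv_mix_ne_top {π : Measure (E d)} [IsProbabilityMeasure π]
    {m m' : P d} {p q : E d → ℝ} (hm : HasRelDensity π m p) (hm' : HasRelDensity π m' q)
    (h : klDiv (m : Measure (E d)) π ≠ ∞) (h' : klDiv (m' : Measure (E d)) π ≠ ∞)
    (l : unitInterval) : klDiv (mix m m' l : Measure (E d)) π ≠ ∞ := by
  have hl := hasRelDensity_mix hm hm' l
  rw [hl.klDiv_ne_top_iff]
  rw [hm.klDiv_ne_top_iff] at h
  rw [hm'.klDiv_ne_top_iff] at h'
  refine ((h.const_mul (1 - (l : ℝ))).add (h'.const_mul (l : ℝ))).mono'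
    (measurable_klFun.comp hl.measurable).aestronglyMeasurable (ae_of_all _ fun x => ?_)
  rw [Real.norm_eq_abs, abs_of_nonneg (klFun_nonneg (hl.nonneg x))]
  exact convexOn_klFun.2 (hm.nonneg x) (hm'.nonneg x) (sub_nonneg.2 l.2.2) l.2.1 (by ring)

theorem HasRelDensity.toReal_klDiv_mix_le {π : Measure (E d)} [IsProbabilityMeasure π]
    {m m' : P d} {p q : E d → ℝ} (hm : HasRelDensity π m p) (hm' : HasRelDensity π m' q)
    (h : klDiv (m : Measure (E d)) π ≠ ∞) (h' : klDiv (m' : Measure (E d)) π ≠ ∞)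
    (l : unitInterval) : (klDiv (mix m m' l : Measure (E d)) π).toReal ≤
      (1 - (l : ℝ)) * (klDiv (m : Measure (E d)) π).toReal +
        l * (klDiv (m' : Measure (E d)) π).toReal := by
  have hl := hasRelDensity_mix hm hm' l
  have hi := hl.klDiv_ne_top_iff.1 (hm.klDiv_mix_ne_top hm' h h' l)
  rw [hm.klDiv_ne_top_iff] at h
  rw [hm'.klDiv_ne_top_iff] at h'
  rw [hl.toReal_klDiv_eq, hm.toReal_klDiv_eq, hm'.toReal_klDiv_eq, ← integral_const_mul,
    ← integral_const_mul, ← integral_add (h.const_mul _) (h'.const_mul _)]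
  refine integral_mono hi ((h.const_mul _).add (h'.const_mul _)) fun x => ?_
  exact convexOn_klFun.2 (hm.nonneg x) (hm'.nonneg x) (sub_nonneg.2 l.2.2) l.2.1 (by ring)

/-- The regularised energy is strongly convex at midpoints with respect to the Hellinger
distance. -/
theorem EnergyAssumption.exists_realEnergy_midpoint (hF : EnergyAssumption F dF d2F)
    [IsProbabilityMeasure (refMeasure U)] {m m' : P d} {p q : E d → ℝ}
    (hm : HasRelDensity (refMeasure U) m p) (hm' : HasRelDensity (refMeasure U) m' q)
    (h : klDiv (m : Measure (E d)) (refMeasure U) ≠ ∞)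
    (h' : klDiv (m' : Measure (E d)) (refMeasure U) ≠ ∞) :
    ∃ μ : P d, klDiv (μ : Measure (E d)) (refMeasure U) ≠ ∞ ∧
      Integrable (fun x => (√(p x) - √(q x)) ^ 2) (refMeasure U) ∧
      realEnergy F U σ μ + σ ^ 2 / 8 * ∫ x, (√(p x) - √(q x)) ^ 2 ∂(refMeasure U) ≤
        (realEnergy F U σ m + realEnergy F U σ m') / 2 := by
  let l : unitInterval := ⟨1 / 2, by norm_num, by norm_num⟩
  have hl := hasRelDensity_mix hm hm' l
  have hk := hm.klDiv_mix_ne_top hm' h h' l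
  have hi := hl.klDiv_ne_top_iff.1 hk
  rw [hm.klDiv_ne_top_iff] at h
  rw [hm'.klDiv_ne_top_iff] at h'
  have hd : Integrable (fun x => (√(p x) - √(q x)) ^ 2) (refMeasure U) := by
    refine (hm.integrable.add hm'.integrable).mono' ?_ (ae_of_all _ fun x => ?_)
    · exact ((hm.measurable.sqrt.sub hm'.measurable.sqrt).pow_const 2).aestronglyMeasurable
    · have e1 := Real.sq_sqrt (hm.nonneg x)
      have e2 := Real.sq_sqrt (hm'.nonneg x)
      have e3 := mul_nonneg (Real.sqrt_nonneg (p x)) (Real.sqrt_nonneg (q x))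
      rw [Real.norm_eq_abs, abs_of_nonneg (sq_nonneg _)]
      simp only [Pi.add_apply]
      nlinarith
  refine ⟨mix m m' l, hk, hd, ?_⟩
  have hkl : (klDiv (mix m m' l : Measure (E d)) (refMeasure U)).toReal +
      (∫ x, (√(p x) - √(q x)) ^ 2 ∂(refMeasure U)) / 4 ≤
      (klDiv (m : Measure (E d)) (refMeasure U)).toReal / 2 +
        (klDiv (m' : Measure (E d)) (refMeasure U)).toReal / 2 := by
    rw [hl.toReal_klDiv_eq, hm.toReal_klDiv_eq, hm'.toReal_klDiv_eq, ← integral_div,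
      ← integral_div, ← integral_div, ← integral_add (h.div_const _) (h'.div_const _),
      ← integral_add hi (hd.div_const _)]
    refine integral_mono (hi.add (hd.div_const _)) ((h.div_const _).add (h'.div_const _))
      fun x => ?_
    have e : (1 - (l : ℝ)) * p x + l * q x = (p x + q x) / 2 := by
      simp only [l]; ring
    simp only [e]
    exact klFun_midpoint_add_sq_le (hm.nonneg x) (hm'.nonneg x)
  obtain ⟨C, -, hC⟩ := hF.first_bounded
  have f1 := hF.convex (mix m m' l) m
  have f2 := hF.convex (mix m m' l) m'
  rw [integralDiff, integral_mix (hF.first.measurable _) (hC _)] at f1 f2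
  have el : (l : ℝ) = 1 / 2 := rfl
  rw [el] at f1 f2
  have h3 := mul_le_mul_of_nonneg_left hkl (by positivity : 0 ≤ σ ^ 2 / 2)
  simp only [realEnergy]
  nlinarith

/-- Two measures whose energies are within `σ² δ² / 8` of a lower bound of the energy have
densities at `L¹`-distance less than `3 δ`: at their midpoint the energy cannot drop below the
lower bound, which limits the squared Hellinger distance to `δ²`. -/
theorem EnergyAssumption.integral_abs_sub_lt (hF : EnergyAssumption F dF d2F) (hσ : 0 < σ)
    [IsProbabilityMeasure (refMeasure U)] {I δ : ℝ} (hδ : 0 < δ)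
    (hI : ∀ μ : P d, klDiv (μ : Measure (E d)) (refMeasure U) ≠ ∞ → I ≤ realEnergy F U σ μ)
    {m m' : P d} {p q : E d → ℝ}
    (hm : HasRelDensity (refMeasure U) m p) (hm' : HasRelDensity (refMeasure U) m' q)
    (h : klDiv (m : Measure (E d)) (refMeasure U) ≠ ∞)
    (h' : klDiv (m' : Measure (E d)) (refMeasure U) ≠ ∞)
    (hlt : realEnergy F U σ m < I + σ ^ 2 / 8 * (δ * δ))
    (hlt' : realEnergy F U σ m' < I + σ ^ 2 / 8 * (δ * δ)) :
    ∫ x, |p x - q x| ∂(refMeasure U) < 3 * δ := by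
  obtain ⟨μ, hμ, hi, hle⟩ := hF.exists_realEnergy_midpoint (σ := σ) hm hm' h h'
  have h0 := hI μ hμ
  have hi' := hi.div_const (2 * δ)
  have hsum : Integrable (fun x => δ * (p x + q x)) (refMeasure U) :=
    (hm.integrable.add hm'.integrable).const_mul δ
  have hb : ∫ x, |p x - q x| ∂(refMeasure U) ≤
      (∫ x, (√(p x) - √(q x)) ^ 2 ∂(refMeasure U)) / (2 * δ) + δ * (1 + 1) := by
    have h1 : ∫ x, |p x - q x| ∂(refMeasure U) ≤
        ∫ x, ((√(p x) - √(q x)) ^ 2 / (2 * δ) + δ * (p x + q x)) ∂(refMeasure U) :=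
      integral_mono (hm.integrable.sub hm'.integrable).abs (hi'.add hsum)
        fun x => abs_sub_le_sq_sqrt_sub (hm.nonneg x) (hm'.nonneg x) hδ
    rwa [integral_add hi' hsum, integral_div, integral_const_mul,
      integral_add hm.integrable hm'.integrable, hm.integral, hm'.integral] at h1
  set D := ∫ x, (√(p x) - √(q x)) ^ 2 ∂(refMeasure U)
  have hD : D < δ * δ := by
    have : σ ^ 2 / 8 * D < σ ^ 2 / 8 * (δ * δ) := by linarith
    exact lt_of_mul_lt_mul_left this (by positivity)
  have hb' : D / (2 * δ) < δ := by
    rw [div_lt_iff₀ (by positivity)]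
    nlinarith
  linarith

/-- The regularised energy attains its infimum: by strong convexity the densities of a
minimizing sequence are Cauchy in `L¹(π)`, and the energy is lower semicontinuous along the limit,
the divergence part by Fatou's lemma. -/
theorem EnergyAssumption.exists_isMinimizer (hF : EnergyAssumption F dF d2F) (hσ : 0 < σ)
    (hUint : Integrable (fun x => Real.exp (-U x))) : ∃ m, IsMinimizer F U σ m := by
  have := isProbabilityMeasure_refMeasure hUint
  obtain ⟨C, hC0, hC⟩ := hF.first_bounded
  have hs : 0 < σ ^ 2 / 2 := by positivity
  let S : Set ℝ :=
    realEnergy F U σ '' {m : P d | klDiv (m : Measure (E d)) (refMeasure U) ≠ ∞}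
  let π' : P d := ⟨refMeasure U, inferInstance⟩
  have hSne : S.Nonempty := ⟨_, π', by
    change klDiv (refMeasure U) (refMeasure U) ≠ ∞
    simp, rfl⟩
  have hSb : BddBelow S := by
    refine ⟨F π' - 2 * C, ?_⟩
    rintro _ ⟨m, -, rfl⟩
    have h1 := hF.convex π' m
    have h2 := (abs_le.1 (abs_integralDiff_le hC π' π' m)).2
    have h3 : 0 ≤ σ ^ 2 / 2 * (klDiv (m : Measure (E d)) (refMeasure U)).toReal := by positivity
    simp only [realEnergy]
    linarith
  set I := sInf S with hI
  have hle : ∀ m : P d, klDiv (m : Measure (E d)) (refMeasure U) ≠ ∞ →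
      I ≤ realEnergy F U σ m := fun m hm => csInf_le hSb ⟨m, hm, rfl⟩
  -- the accuracy `σ² δ² / 8` with `δ = 4⁻ⁿ` makes the `L¹`-distances summable
  have hex : ∀ n : ℕ, ∃ m : P d, klDiv (m : Measure (E d)) (refMeasure U) ≠ ∞ ∧
      realEnergy F U σ m < I + σ ^ 2 / 8 * (1 / 4 ^ n * (1 / 4 ^ n)) := fun n => by
    obtain ⟨_, ⟨m, hm, rfl⟩, h⟩ := exists_lt_of_csInf_lt hSne
      (show sInf S < I + σ ^ 2 / 8 * (1 / 4 ^ n * (1 / 4 ^ n)) from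
        lt_add_of_pos_right _ (by positivity))
    exact ⟨m, hm, h⟩
  choose ms hfin hlt using hex
  let ps : ℕ → E d → ℝ := fun n x => ((ms n : Measure (E d)).rnDeriv (refMeasure U) x).toReal
  have hps : ∀ n, HasRelDensity (refMeasure U) (ms n) (ps n) := fun n =>
    hasRelDensity_rnDeriv (InformationTheory.klDiv_ne_top_iff.1 (hfin n)).1
  have hcau : ∀ N n k, N ≤ n → N ≤ k →
      ∫ x, |ps n x - ps k x| ∂(refMeasure U) < 3 * (1 / 4) ^ N := by
    intro N n k hn hk
    have key : ∀ j, N ≤ j → realEnergy F U σ (ms j) <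
        I + σ ^ 2 / 8 * (1 / 4 ^ N * (1 / 4 ^ N)) := fun j hj => by
      have : (1 : ℝ) / 4 ^ j ≤ 1 / 4 ^ N :=
        one_div_le_one_div_of_le (by positivity) (pow_le_pow_right₀ (by norm_num) hj)
      refine (hlt j).trans_le ?_
      gcongr
    rw [one_div_pow]
    exact hF.integral_abs_sub_lt hσ (by positivity) hle (hps n) (hps k) (hfin n) (hfin k)
      (key n hn) (key k hk)
  obtain ⟨μ, p, hμ, hp, hae, hL1⟩ := exists_hasRelDensity_of_cauchy hps
    ((summable_geometric_of_lt_one (by norm_num) (by norm_num : (1 / 4 : ℝ) < 1)).mul_left 3) hcau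
  let m : P d := ⟨μ, hμ⟩
  have hm : HasRelDensity (refMeasure U) (m : Measure (E d)) p := hp
  -- nonnegativity is recorded because `ENNReal.ofReal` truncates negative values to `0`
  have hbound : ∀ ε > 0, 0 ≤ (I + ε - F m) / (σ ^ 2 / 2) ∧
      klDiv (m : Measure (E d)) (refMeasure U) ≤
        ENNReal.ofReal ((I + ε - F m) / (σ ^ 2 / 2)) := by
    intro ε hε
    have hev : ∀ᶠ n in atTop, 0 ≤ (I + ε - F m) / (σ ^ 2 / 2) ∧
        klDiv (ms n : Measure (E d)) (refMeasure U) ≤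
          ENNReal.ofReal ((I + ε - F m) / (σ ^ 2 / 2)) := by
      have t1 : Tendsto (fun n : ℕ => σ ^ 2 / 8 * ((1 : ℝ) / 4 ^ n * (1 / 4 ^ n)) +
          C * ∫ x, |ps n x - p x| ∂(refMeasure U)) atTop (𝓝 0) := by
        have : Tendsto (fun n : ℕ => (1 : ℝ) / 4 ^ n) atTop (𝓝 0) := by
          simpa [one_div_pow] using
            tendsto_pow_atTop_nhds_zero_of_lt_one (by norm_num) (by norm_num : (1 / 4 : ℝ) < 1)
        simpa using ((this.mul this).const_mul (σ ^ 2 / 8)).add (hL1.const_mul C)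
      filter_upwards [t1.eventually (gt_mem_nhds hε)] with n hn
      have h1 := hF.le_integral_abs hC hm (hps n)
      have h2 := hlt n
      simp only [realEnergy] at h2
      have h3 : (klDiv (ms n : Measure (E d)) (refMeasure U)).toReal ≤
          (I + ε - F m) / (σ ^ 2 / 2) := by
        rw [le_div_iff₀ hs]
        linarith
      refine ⟨ENNReal.toReal_nonneg.trans h3, ?_⟩
      rw [← ENNReal.ofReal_toReal (hfin n)]
      exact ENNReal.ofReal_le_ofReal h3
    have hFatou : klDiv (m : Measure (E d)) (refMeasure U) ≤
        liminf (fun n => klDiv (ms n : Measure (E d)) (refMeasure U)) atTop := by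
      simp only [hm.klDiv_eq, (hps _).klDiv_eq]
      refine le_trans (le_of_eq ?_) (lintegral_liminf_le fun n =>
        (measurable_klFun.comp (hps n).measurable).ennreal_ofReal)
      refine lintegral_congr_ae ?_
      filter_upwards [hae] with x hx
      exact (((ENNReal.continuous_ofReal.comp continuous_klFun).tendsto (p x)).comp
        hx).liminf_eq.symm
    obtain ⟨_, hn, -⟩ := hev.exists
    exact ⟨hn, hFatou.trans (liminf_le_of_frequently_le' (hev.mono fun _ h => h.2).frequently)⟩
  have hmfin : klDiv (m : Measure (E d)) (refMeasure U) ≠ ∞ :=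
    ((hbound 1 one_pos).2.trans_lt ENNReal.ofReal_lt_top).ne
  refine ⟨m, (isMinimizer_iff hσ hUint).2 ⟨hmfin, fun m' hm' => ?_⟩⟩
  refine le_trans (le_of_forall_pos_le_add fun ε hε => ?_) (hle m' hm')
  obtain ⟨hnn, hb⟩ := hbound ε hε
  have hb' := ENNReal.toReal_le_of_le_ofReal hnn hb
  rw [le_div_iff₀ hs] at hb'
  simp only [realEnergy]
  linarith

end Energy

/-! ### The Gibbs form of minimizers -/

section Gibbs

variable {d : ℕ} {F : P d → ℝ} {dF : P d → E d → ℝ} {d2F : P d → E d → E d → ℝ}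
  {U : E d → ℝ} {σ : ℝ}

/-- The first order condition at a minimizer `m`, tested against `μ`. It follows by comparing `m`
with the mixtures `m + l (μ - m)` as `l → 0`, bounding the energy increment by convexity. -/
theorem IsMinimizer.first_order {m : P d} (hmin : IsMinimizer F U σ m)
    (hF : EnergyAssumption F dF d2F) (hσ : 0 < σ)
    (hUint : Integrable (fun x => Real.exp (-U x))) {μ : P d}
    (hμ : klDiv (μ : Measure (E d)) (refMeasure U) ≠ ∞) :
    0 ≤ integralDiff (dF m) μ m + σ ^ 2 / 2 *
      ((klDiv (μ : Measure (E d)) (refMeasure U)).toReal -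
        (klDiv (m : Measure (E d)) (refMeasure U)).toReal) := by
  have := isProbabilityMeasure_refMeasure hUint
  obtain ⟨hm, hle⟩ := (isMinimizer_iff hσ hUint).1 hmin
  obtain ⟨C, -, hC⟩ := hF.first_bounded
  have hp := hasRelDensity_rnDeriv (InformationTheory.klDiv_ne_top_iff.1 hm).1
  have hq := hasRelDensity_rnDeriv (InformationTheory.klDiv_ne_top_iff.1 hμ).1
  let l : ℕ → unitInterval := fun n => ⟨1 / ((n : ℝ) + 1), by positivity, by
    rw [div_le_one (by positivity)]
    linarith [(Nat.cast_nonneg n : (0 : ℝ) ≤ n)]⟩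
  have hl : Tendsto (fun n => (l n : ℝ)) atTop (𝓝 0) := tendsto_one_div_add_atTop_nhds_zero_nat
  have hmix : Tendsto (fun n => mix m μ (l n)) atTop (𝓝 m) := tendsto_mix hl
  have hint : ∀ ν : P d, Tendsto
      (fun n => ∫ x, dF (mix m μ (l n)) x ∂(ν : Measure (E d))) atTop
      (𝓝 (∫ x, dF m x ∂(ν : Measure (E d)))) := fun ν =>
    tendsto_integral_of_dominated_convergence (fun _ => C)
      (fun n => (hF.first.measurable _).aestronglyMeasurable) (integrable_const C)
      (fun n => ae_of_all _ (hC _))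
      (ae_of_all _ fun x => ((hF.first.continuous x).tendsto m).comp hmix)
  refine ge_of_tendsto' (((hint μ).sub (hint m)).add_const (σ ^ 2 / 2 *
      ((klDiv (μ : Measure (E d)) (refMeasure U)).toReal -
        (klDiv (m : Measure (E d)) (refMeasure U)).toReal))) fun n => ?_
  have hln : 0 < (l n : ℝ) := by simp only [l]; positivity
  have h1 := hle _ (hp.klDiv_mix_ne_top hq hm hμ (l n))
  have h2 := hp.toReal_klDiv_mix_le hq hm hμ (l n)
  have h3 := hF.convex (mix m μ (l n)) m
  rw [integralDiff_mix (hF.first.measurable _) (hC _), integralDiff] at h3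
  simp only [realEnergy] at h1
  have h4 := mul_le_mul_of_nonneg_left h2 (by positivity : 0 ≤ σ ^ 2 / 2)
  refine nonneg_of_mul_nonneg_right (a := (l n : ℝ)) ?_ hln
  nlinarith

theorem integrable_exp_of_bounded {α : Type*} [MeasurableSpace α] {π : Measure α}
    [IsProbabilityMeasure π] {f : α → ℝ} (hf : Measurable f) {C : ℝ} (hC : ∀ x, |f x| ≤ C) :
    Integrable (fun x => Real.exp (f x)) π :=
  Integrable.of_bound hf.exp.aestronglyMeasurable (Real.exp C) (ae_of_all _ fun x => by
    rw [Real.norm_eq_abs, Real.abs_exp]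
    exact Real.exp_le_exp.2 (le_of_abs_le (hC x)))

theorem klDiv_tilted_self {α : Type*} [MeasurableSpace α] {π : Measure α}
    [IsProbabilityMeasure π] {f : α → ℝ} (hf : Measurable f) {C : ℝ} (hC : ∀ x, |f x| ≤ C) :
    klDiv (π.tilted f) π ≠ ∞ ∧ (klDiv (π.tilted f) π).toReal =
      ∫ x, f x ∂(π.tilted f) - Real.log (∫ x, Real.exp (f x) ∂π) := by
  have he := integrable_exp_of_bounded (π := π) hf hC
  have := isProbabilityMeasure_tilted he
  have hac := tilted_absolutelyContinuous π f
  have hfi : Integrable f (π.tilted f) :=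
    Integrable.of_bound hf.aestronglyMeasurable C (ae_of_all _ hC)
  have hllr : llr (π.tilted f) π =ᵐ[π.tilted f]
      fun x => f x - Real.log (∫ x, Real.exp (f x) ∂π) :=
    hac.ae_le (log_rnDeriv_tilted_left_self he)
  refine ⟨klDiv_ne_top hac ((integrable_congr hllr).2 (hfi.sub (integrable_const _))), ?_⟩
  rw [toReal_klDiv_of_measure_eq hac (by simp), integral_congr_ae hllr,
    integral_sub hfi (integrable_const _)]
  simp

/-- The Gibbs variational identity for the divergence relative to a tilted measure. -/
theorem klDiv_tilted_right {α : Type*} [MeasurableSpace α] {π ν : Measure α}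
    [IsProbabilityMeasure π] [IsProbabilityMeasure ν] {f : α → ℝ} (hf : Measurable f) {C : ℝ}
    (hC : ∀ x, |f x| ≤ C) (hν : klDiv ν π ≠ ∞) :
    klDiv ν (π.tilted f) ≠ ∞ ∧ (klDiv ν (π.tilted f)).toReal =
      (klDiv ν π).toReal - ∫ x, f x ∂ν + Real.log (∫ x, Real.exp (f x) ∂π) := by
  have he := integrable_exp_of_bounded (π := π) hf hC
  have := isProbabilityMeasure_tilted he
  obtain ⟨hac, hi⟩ := InformationTheory.klDiv_ne_top_iff.1 hν
  have hfi : Integrable f ν := Integrable.of_bound hf.aestronglyMeasurable C (ae_of_all _ hC)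
  have hac' : ν ≪ π.tilted f := hac.trans (absolutelyContinuous_tilted he)
  refine ⟨klDiv_ne_top hac' (integrable_llr_tilted_right hac hfi hi he), ?_⟩
  rw [toReal_klDiv_of_measure_eq hac' (by simp), toReal_klDiv_of_measure_eq hac (by simp),
    integral_llr_tilted_right hac hfi he hi]

/-- A minimizer is the reference measure tilted by `-(2 / σ²) δF/δm`. Testing the first order
condition against the tilted measure gives a nonpositive divergence of the minimizer from it. -/
theorem IsMinimizer.eq_tilted {m : P d} (hmin : IsMinimizer F U σ m)
    (hF : EnergyAssumption F dF d2F) (hσ : 0 < σ)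
    (hUint : Integrable (fun x => Real.exp (-U x))) :
    (m : Measure (E d)) = (refMeasure U).tilted fun x => -(2 / σ ^ 2) * dF m x := by
  have := isProbabilityMeasure_refMeasure hUint
  obtain ⟨hm, -⟩ := (isMinimizer_iff hσ hUint).1 hmin
  obtain ⟨C, -, hC⟩ := hF.first_bounded
  set f : E d → ℝ := fun x => -(2 / σ ^ 2) * dF m x with hfdef
  have hf : Measurable f := (hF.first.measurable m).const_mul _
  have hfC : ∀ x, |f x| ≤ 2 / σ ^ 2 * C := fun x => by
    rw [hfdef, abs_mul, abs_neg, abs_of_nonneg (by positivity : 0 ≤ 2 / σ ^ 2)]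
    exact mul_le_mul_of_nonneg_left (hC m x) (by positivity)
  have := isProbabilityMeasure_tilted (integrable_exp_of_bounded (π := refMeasure U) hf hfC)
  let μ : P d := ⟨(refMeasure U).tilted f, this⟩
  obtain ⟨k1, e1⟩ := klDiv_tilted_self (π := refMeasure U) hf hfC
  obtain ⟨k2, e2⟩ := klDiv_tilted_right hf hfC hm
  have hfo := hmin.first_order hF hσ hUint (μ := μ) k1
  have hμ : (μ : Measure (E d)) = (refMeasure U).tilted f := rfl
  rw [integralDiff, hμ, e1] at hfo
  have hint : ∀ ν : Measure (E d), ∫ x, f x ∂ν = -(2 / σ ^ 2) * ∫ x, dF m x ∂ν := fun ν =>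
    integral_const_mul _ _
  rw [hint] at e2 hfo
  have hσ2 : σ ^ 2 / 2 * (2 / σ ^ 2) = 1 := by field_simp
  have h0 : σ ^ 2 / 2 * (klDiv (m : Measure (E d)) ((refMeasure U).tilted f)).toReal ≤ 0 := by
    rw [e2]
    linear_combination hfo + (∫ x, dF m x ∂(m : Measure (E d)) -
      ∫ x, dF m x ∂((refMeasure U).tilted f)) * hσ2
  have h1 : (klDiv (m : Measure (E d)) ((refMeasure U).tilted f)).toReal = 0 :=
    le_antisymm (nonpos_of_mul_nonpos_right h0 (by positivity)) ENNReal.toReal_nonneg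
  rcases (ENNReal.toReal_eq_zero_iff _).1 h1 with h | h
  · exact klDiv_eq_zero_iff.1 h
  · exact absurd h k2

theorem gibbsWeight_eq (hUint : Integrable (fun x => Real.exp (-U x))) (m : P d) (x : E d) :
    gibbsWeight dF U σ m x = (∫ y, Real.exp (-U y)) *
      (refDensity U x * Real.exp (-(2 / σ ^ 2) * dF m x)) := by
  have := (integral_exp_neg_pos hUint).ne'
  rw [gibbsWeight, refDensity, sub_eq_add_neg, Real.exp_add]
  field_simp

theorem gibbsDensity_eq (hU : Measurable U) (hUint : Integrable (fun x => Real.exp (-U x)))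
    (m : P d) (x : E d) :
    gibbsDensity dF U σ m x = refDensity U x *
      (Real.exp (-(2 / σ ^ 2) * dF m x) /
        ∫ y, Real.exp (-(2 / σ ^ 2) * dF m y) ∂(refMeasure U)) := by
  have := (integral_exp_neg_pos hUint).ne'
  simp only [gibbsDensity, gibbsWeight_eq hUint]
  rw [integral_const_mul, ← (hasRelDensity_refMeasure hU hUint).integral_eq,
    mul_div_mul_left _ _ this, mul_div_assoc]

theorem IsMinimizer.hasDensity_gibbsDensity {m : P d} (hmin : IsMinimizer F U σ m)
    (hF : EnergyAssumption F dF d2F) (hσ : 0 < σ) (hU : Measurable U)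
    (hUint : Integrable (fun x => Real.exp (-U x))) :
    HasDensity m (gibbsDensity dF U σ m) := by
  have hg : gibbsDensity dF U σ m = fun x => refDensity U x *
      (Real.exp (-(2 / σ ^ 2) * dF m x) /
        ∫ y, Real.exp (-(2 / σ ^ 2) * dF m y) ∂(refMeasure U)) :=
    funext fun x => gibbsDensity_eq hU hUint m x
  have hmeas : Measurable fun x => Real.exp (-(2 / σ ^ 2) * dF m x) /
      ∫ y, Real.exp (-(2 / σ ^ 2) * dF m y) ∂(refMeasure U) :=
    ((hF.first.measurable m).const_mul _).exp.div_const _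
  have hmeas' := measurable_refDensity hU
  refine ⟨hg ▸ hmeas'.mul hmeas, fun x => ?_, ?_⟩
  · rw [hg]
    exact mul_nonneg (refDensity_pos hUint x).le
      (div_nonneg (Real.exp_pos _).le (integral_nonneg fun _ => (Real.exp_pos _).le))
  · conv_lhs => rw [hmin.eq_tilted hF hσ hUint]
    refine (withDensity_mul volume hmeas'.ennreal_ofReal hmeas.ennreal_ofReal).symm.trans ?_
    rw [hg]
    congr 1
    ext x
    rw [ENNReal.ofReal_mul (refDensity_pos hUint x).le]
    rfl

/-- The Gibbs density is comparable to the reference density. -/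
theorem exists_gibbsDensity_bounds (hF : EnergyAssumption F dF d2F) (hU : Measurable U)
    (hUint : Integrable (fun x => Real.exp (-U x))) (m : P d) :
    ∃ c > 0, ∃ c' > 0, ∀ x, c * refDensity U x ≤ gibbsDensity dF U σ m x ∧
      gibbsDensity dF U σ m x ≤ c' * refDensity U x := by
  have := isProbabilityMeasure_refMeasure hUint
  obtain ⟨C, -, hC⟩ := hF.first_bounded
  have hfC : ∀ x, |-(2 / σ ^ 2) * dF m x| ≤ 2 / σ ^ 2 * C := fun x => by
    rw [abs_mul, abs_neg, abs_of_nonneg (by positivity : 0 ≤ 2 / σ ^ 2)]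
    exact mul_le_mul_of_nonneg_left (hC m x) (by positivity)
  have hZ : 0 < ∫ y, Real.exp (-(2 / σ ^ 2) * dF m y) ∂(refMeasure U) :=
    integral_exp_pos (integrable_exp_of_bounded ((hF.first.measurable m).const_mul _) hfC)
  refine ⟨_, div_pos (Real.exp_pos (-(2 / σ ^ 2 * C))) hZ, _,
    div_pos (Real.exp_pos (2 / σ ^ 2 * C)) hZ, fun x => ?_⟩
  have h := abs_le.1 (hfC x)
  have hp := (refDensity_pos hUint x).le
  rw [gibbsDensity_eq hU hUint, mul_comm (refDensity U x)]
  exact ⟨mul_le_mul_of_nonneg_right (div_le_div_of_nonneg_right (Real.exp_le_exp.2 h.1) hZ.le) hp,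
    mul_le_mul_of_nonneg_right (div_le_div_of_nonneg_right (Real.exp_le_exp.2 h.2) hZ.le) hp⟩

end Gibbs

/-! ### Uniform bounds along the birth-death flow -/

section Flow

/-- A function on `[0, ∞)` whose derivative is positive at each time where it equals `c` stays
above `c` once it starts there. -/
theorem le_of_deriv_pos_of_eq {f f' : ℝ → ℝ} {c : ℝ}
    (hf : ∀ t, 0 ≤ t → HasDerivWithinAt f (f' t) (Ici 0) t) (h0 : c ≤ f 0)
    (h : ∀ t, 0 ≤ t → f t = c → 0 < f' t) {t : ℝ} (ht : 0 ≤ t) : c ≤ f t := by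
  have key := image_le_of_deriv_right_lt_deriv_boundary' (f := fun s => -f s)
    (f' := fun s => -f' s) (a := 0) (b := t) (B := fun _ => -c) (B' := fun _ => 0)
    (fun s hs => ((hf s hs.1).continuousWithinAt.mono Icc_subset_Ici_self).neg)
    (fun s hs => ((hf s hs.1).mono (Ici_subset_Ici.2 hs.1)).neg)
    (neg_le_neg h0) continuousOn_const (fun s _ => hasDerivWithinAt_const _ _ _)
    (fun s hs hs' => neg_lt_zero.2 (h s hs.1 (neg_injective hs')))
  exact neg_le_neg_iff.1 (key ⟨ht, le_rfl⟩)

variable {d : ℕ} {F : P d → ℝ} {dF : P d → E d → ℝ} {d2F : P d → E d → E d → ℝ}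
  {U : E d → ℝ} {σ : ℝ} {m₀ : P d} {ρ₀ : E d → ℝ} {m : ℝ → P d} {ρ : ℝ → E d → ℝ}

/-- The densities of the flow stay positive: the relative entropy enters the equation with the
sign that increases the density, so a small enough multiple of `π` is a barrier from below. -/
theorem IsBirthDeathFlow.density_pos (hm : IsBirthDeathFlow dF U σ m₀ ρ₀ m ρ)
    (hF : EnergyAssumption F dF d2F) (hσ : 0 < σ)
    (hUint : Integrable (fun x => Real.exp (-U x))) (hm₀ : InitialAssumption U m₀ ρ₀)
    {t : ℝ} (ht : 0 ≤ t) (x : E d) : 0 < ρ t x := by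
  obtain ⟨C, hC0, hC⟩ := hF.first_bounded
  obtain ⟨r, hr, hlow⟩ := hm₀.lower
  have hπ := refDensity_pos hUint x
  have hs : 0 < σ ^ 2 / 2 := by positivity
  -- the barrier is `exp (-L) π(x)`; at this height the rate is at most `C - σ² L / 2 < 0`
  set L : ℝ := max (-Real.log r) (C / (σ ^ 2 / 2) + 1) with hL
  have hc : 0 < Real.exp (-L) * refDensity U x := by positivity
  refine hc.trans_le (le_of_deriv_pos_of_eq (fun t ht => hm.deriv t ht x) ?_ ?_ ht)
  · rw [hm.init_density, ← le_div_iff₀ hπ]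
    refine le_trans ?_ (hlow x)
    rw [← Real.le_log_iff_exp_le hr]
    linarith [le_max_left (-Real.log r) (C / (σ ^ 2 / 2) + 1)]
  · intro t ht heq
    rw [heq]
    refine mul_pos (neg_pos.2 ?_) hc
    rw [rate, heq, mul_div_assoc, div_self hπ.ne', mul_one, Real.log_exp]
    have h1 : C / (σ ^ 2 / 2) + 1 ≤ L := le_max_right _ _
    have h2 := mul_le_mul_of_nonneg_left h1 hs.le
    rw [mul_add, mul_div_cancel₀ _ hs.ne'] at h2
    have h3 : 0 ≤ σ ^ 2 / 2 * (klDiv (m t : Measure (E d)) (refMeasure U)).toReal := by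
      positivity
    have h4 := le_of_abs_le (hC (m t) x)
    nlinarith

/-- The oscillation of the log-density relative to `π` is bounded uniformly in time. In the
equation for a difference of two values of the log-density the divergence cancels, and a linear
damping remains. -/
theorem IsBirthDeathFlow.exists_log_sub_log_le (hm : IsBirthDeathFlow dF U σ m₀ ρ₀ m ρ)
    (hF : EnergyAssumption F dF d2F) (hσ : 0 < σ)
    (hUint : Integrable (fun x => Real.exp (-U x))) (hm₀ : InitialAssumption U m₀ ρ₀) :
    ∃ M : ℝ, ∀ t, 0 ≤ t → ∀ x y, -M ≤
      Real.log (ρ t x / refDensity U x) - Real.log (ρ t y / refDensity U y) := by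
  obtain ⟨C, hC0, hC⟩ := hF.first_bounded
  obtain ⟨r, hr, hlow⟩ := hm₀.lower
  obtain ⟨R, hR, hup⟩ := hm₀.upper
  have hs : 0 < σ ^ 2 / 2 := by positivity
  -- the first entry bounds the initial oscillation; at a difference of `-M` the second one makes
  -- the damping `σ² M / 2` exceed the source, which is at most `2 C`
  refine ⟨max (Real.log R - Real.log r) (2 * C / (σ ^ 2 / 2) + 1), fun t ht x y => ?_⟩
  have hd : ∀ z t, 0 ≤ t → HasDerivWithinAt (fun s => Real.log (ρ s z / refDensity U z))
      (-(rate dF U σ (m t) (ρ t) z)) (Ici 0) t := fun z t ht => by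
    have hπ := (refDensity_pos hUint z).ne'
    have hρ := (hm.density_pos hF hσ hUint hm₀ ht z).ne'
    have := ((hm.deriv t ht z).div_const (refDensity U z)).log (div_ne_zero hρ hπ)
    convert this using 1
    field_simp
  refine le_of_deriv_pos_of_eq (fun t ht => (hd x t ht).sub (hd y t ht)) ?_ ?_ ht
  · simp only [Pi.sub_apply, hm.init_density]
    have h1 := Real.log_le_log hr (hlow x)
    have h2 := Real.log_le_log (hr.trans_le (hlow y)) (hup y)
    linarith [le_max_left (Real.log R - Real.log r) (2 * C / (σ ^ 2 / 2) + 1)]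
  · intro t ht heq
    have h1 : 2 * C / (σ ^ 2 / 2) + 1 ≤
      max (Real.log R - Real.log r) (2 * C / (σ ^ 2 / 2) + 1) := le_max_right _ _
    have h2 := mul_le_mul_of_nonneg_left h1 hs.le
    rw [mul_add, mul_div_cancel₀ _ hs.ne'] at h2
    have h3 := abs_le.1 (hC (m t) x)
    have h4 := abs_le.1 (hC (m t) y)
    have h5 := congrArg (fun z => σ ^ 2 / 2 * z) heq
    simp only [Pi.sub_apply] at h5
    simp only [rate]
    linarith

/-- The density of the flow relative to `π` is bounded above and below uniformly in time: it has
mean `1`, so its logarithm takes a value `≤ 0` and a value `≥ 0` and is bounded by its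
oscillation. -/
theorem IsBirthDeathFlow.exists_ratio_bounds (hm : IsBirthDeathFlow dF U σ m₀ ρ₀ m ρ)
    (hF : EnergyAssumption F dF d2F) (hσ : 0 < σ) (hU : Measurable U)
    (hUint : Integrable (fun x => Real.exp (-U x))) (hm₀ : InitialAssumption U m₀ ρ₀) :
    ∃ M : ℝ, ∀ t, 0 ≤ t → ∀ x,
      Real.exp (-M) ≤ ρ t x / refDensity U x ∧ ρ t x / refDensity U x ≤ Real.exp M := by
  have := isProbabilityMeasure_refMeasure hUint
  obtain ⟨M, hM⟩ := hm.exists_log_sub_log_le hF hσ hUint hm₀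
  refine ⟨M, fun t ht x => ?_⟩
  have hd := (hm.density t ht).hasRelDensity hU hUint
  have hpos : ∀ z, 0 < ρ t z / refDensity U z := fun z =>
    div_pos (hm.density_pos hF hσ hUint hm₀ ht z) (refDensity_pos hUint z)
  obtain ⟨y, hy⟩ := exists_le_integral hd.integrable
  obtain ⟨z, hz⟩ := exists_integral_le hd.integrable
  rw [hd.integral] at hy hz
  have h1 := Real.log_nonpos (hpos y).le hy
  have h2 := Real.log_nonneg hz
  have h3 := hM t ht x z
  have h4 := hM t ht y x
  rw [← Real.le_log_iff_exp_le (hpos x), ← Real.log_le_iff_le_exp (hpos x)]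
  constructor <;> linarith

theorem IsBirthDeathFlow.exists_ratio_gibbsDensity_bounds
    (hm : IsBirthDeathFlow dF U σ m₀ ρ₀ m ρ)
    (hF : EnergyAssumption F dF d2F) (hσ : 0 < σ) (hU : Measurable U)
    (hUint : Integrable (fun x => Real.exp (-U x))) (hm₀ : InitialAssumption U m₀ ρ₀)
    (μ : P d) :
    ∃ r > 0, ∃ R > 1, ∀ t, 0 ≤ t → ∀ x,
      r ≤ ρ t x / gibbsDensity dF U σ μ x ∧ ρ t x / gibbsDensity dF U σ μ x ≤ R := by
  obtain ⟨M, hM⟩ := hm.exists_ratio_bounds hF hσ hU hUint hm₀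
  obtain ⟨c, hc, c', hc', hg⟩ := exists_gibbsDensity_bounds (σ := σ) hF hU hUint μ
  refine ⟨Real.exp (-M) / c', by positivity, max (Real.exp M / c) 2,
    lt_max_of_lt_right one_lt_two, fun t ht x => ?_⟩
  obtain ⟨h1, h2⟩ := hM t ht x
  obtain ⟨h3, h4⟩ := hg x
  have hπ := refDensity_pos hUint x
  rw [le_div_iff₀ hπ] at h1
  rw [div_le_iff₀ hπ] at h2
  have hpos : 0 < gibbsDensity dF U σ μ x := (mul_pos hc hπ).trans_le h3
  constructor
  · rw [div_le_div_iff₀ hc' hpos]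
    calc Real.exp (-M) * gibbsDensity dF U σ μ x
        ≤ Real.exp (-M) * (c' * refDensity U x) := by gcongr
      _ = Real.exp (-M) * refDensity U x * c' := by ring
      _ ≤ ρ t x * c' := by gcongr
  · refine le_trans ?_ (le_max_left _ _)
    rw [div_le_div_iff₀ hpos hc]
    calc ρ t x * c ≤ Real.exp M * refDensity U x * c := by gcongr
      _ = Real.exp M * (c * refDensity U x) := by ring
      _ ≤ Real.exp M * gibbsDensity dF U σ μ x := by gcongr

end Flow

/-! ### The Polyak–Łojasiewicz inequality -/

section Inequality

variable {d : ℕ} {F : P d → ℝ} {dF : P d → E d → ℝ} {d2F : P d → E d → E d → ℝ}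
  {U : E d → ℝ} {σ : ℝ}

/-- Young's inequality behind the Polyak–Łojasiewicz bound: the linear term `a (p - q)` is absorbed
by the relative entropy of `q` with respect to `p`, at the cost of a multiple of `a² p`. -/
theorem mul_sub_sub_entropy_le {a c p q r : ℝ} (hc : 0 < c) (hp : 0 < p) (hq : 0 ≤ q)
    (hr : 0 < r) (hr1 : r ≤ 1) (hrq : r * q ≤ p) :
    a * (p - q) - c * (q * Real.log q - q * Real.log p - q + p) ≤ a ^ 2 * p / (c * r) := by
  have h1 := sq_sqrt_sub_sqrt_le hq hp
  have e : p - q = (√p - √q) * (√p + √q) := by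
    nlinarith [Real.sq_sqrt hp.le, Real.sq_sqrt hq]
  have h2 : (√p + √q) ^ 2 ≤ 4 * (p / r) := by
    have h3 : (√p + √q) ^ 2 ≤ 2 * (p + q) := by
      nlinarith [Real.sq_sqrt hp.le, Real.sq_sqrt hq, sq_nonneg (√p - √q)]
    have h4 : q ≤ p / r := by rw [le_div_iff₀ hr]; linarith
    have h5 : p ≤ p / r := by rw [le_div_iff₀ hr]; nlinarith
    linarith
  have h6 : a * (p - q) ≤ c * (√p - √q) ^ 2 + a ^ 2 / (4 * c) * (√p + √q) ^ 2 := by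
    have : c * (√p - √q) ^ 2 + a ^ 2 / (4 * c) * (√p + √q) ^ 2 - a * (p - q) =
        (2 * c * (√p - √q) - a * (√p + √q)) ^ 2 / (4 * c) := by
      rw [e]
      field_simp
      ring
    have h7 : 0 ≤ (2 * c * (√p - √q) - a * (√p + √q)) ^ 2 / (4 * c) := by positivity
    linarith
  have h8 : a ^ 2 / (4 * c) * (√p + √q) ^ 2 ≤ a ^ 2 / (4 * c) * (4 * (p / r)) :=
    mul_le_mul_of_nonneg_left h2 (by positivity)
  have h9 : a ^ 2 / (4 * c) * (4 * (p / r)) = a ^ 2 * p / (c * r) := by field_simp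
  have h10 := mul_le_mul_of_nonneg_left h1 hc.le
  have h11 : (√p - √q) ^ 2 = (√q - √p) ^ 2 := by ring
  rw [h11] at h6
  linarith

/-- The energy gap between `m` and `μ` is controlled by the rate of `m` in `L²(m)` as soon as the
density of `μ` is at most `r⁻¹` times that of `m`. -/
theorem EnergyAssumption.realEnergy_sub_le (hF : EnergyAssumption F dF d2F) (hσ : 0 < σ)
    (hUint : Integrable (fun x => Real.exp (-U x))) {m μ : P d} {ρ q : E d → ℝ} {r : ℝ}
    (hm : HasRelDensity (refMeasure U) m fun x => ρ x / refDensity U x)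
    (hμ : HasRelDensity (refMeasure U) μ q) (hpos : ∀ x, 0 < ρ x / refDensity U x)
    (hkm : klDiv (m : Measure (E d)) (refMeasure U) ≠ ∞)
    (hkμ : klDiv (μ : Measure (E d)) (refMeasure U) ≠ ∞)
    (hL2 : MemLp (rate dF U σ m ρ) 2 (m : Measure (E d)))
    (hr : 0 < r) (hrq : ∀ x, r * q x ≤ ρ x / refDensity U x) :
    r ≤ 1 ∧ realEnergy F U σ m - realEnergy F U σ μ ≤
      2 / (σ ^ 2 * r) * ∫ x, rate dF U σ m ρ x ^ 2 ∂(m : Measure (E d)) := by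
  have := isProbabilityMeasure_refMeasure hUint
  obtain ⟨C, -, hC⟩ := hF.first_bounded
  have hr1 : r ≤ 1 := by
    have := integral_mono (hμ.integrable.const_mul r) hm.integrable hrq
    rwa [integral_const_mul, hμ.integral, hm.integral, mul_one] at this
  refine ⟨hr1, ?_⟩
  have hc : 0 < σ ^ 2 / 2 := by positivity
  have hconv := hF.convex m μ
  rw [integralDiff_eq_integral hm hμ (hF.first.measurable m) (hC m)] at hconv
  set p : E d → ℝ := fun x => ρ x / refDensity U x with hpdef
  set k := (klDiv (m : Measure (E d)) (refMeasure U)).toReal with hk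
  have hip := hm.klDiv_ne_top_iff.1 hkm
  have hiq := hμ.klDiv_ne_top_iff.1 hkμ
  have hisub : Integrable (fun x => p x - q x) (refMeasure U) := hm.integrable.sub hμ.integrable
  have hiF : Integrable (fun x => dF m x * (p x - q x)) (refMeasure U) :=
    hisub.bdd_mul (hF.first.measurable m).aestronglyMeasurable (ae_of_all _ (hC m))
  have hikl : Integrable (fun x => σ ^ 2 / 2 * (klFun (p x) - klFun (q x))) (refMeasure U) :=
    (hip.sub hiq).const_mul _
  have hia : Integrable (fun x => p x * rate dF U σ m ρ x ^ 2) (refMeasure U) :=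
    hm.integrable_iff.1 hL2.integrable_sq
  have hik : Integrable (fun x => σ ^ 2 / 2 * k * (p x - q x)) (refMeasure U) :=
    hisub.const_mul _
  have hiK : Integrable (fun x => 2 / (σ ^ 2 * r) * (p x * rate dF U σ m ρ x ^ 2))
      (refMeasure U) := hia.const_mul _
  have hpt : ∀ x, dF m x * (p x - q x) + σ ^ 2 / 2 * (klFun (p x) - klFun (q x)) ≤
      2 / (σ ^ 2 * r) * (p x * rate dF U σ m ρ x ^ 2) + σ ^ 2 / 2 * k * (p x - q x) := fun x => by
    have h := mul_sub_sub_entropy_le (a := rate dF U σ m ρ x) hc (hpos x) (hμ.nonneg x) hr hr1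
      (hrq x)
    have e1 : rate dF U σ m ρ x ^ 2 * p x / (σ ^ 2 / 2 * r) =
        2 / (σ ^ 2 * r) * (p x * rate dF U σ m ρ x ^ 2) := by field_simp
    have e2 : rate dF U σ m ρ x = dF m x + σ ^ 2 / 2 * Real.log (p x) - σ ^ 2 / 2 * k := rfl
    change _ ≤ rate dF U σ m ρ x ^ 2 * p x / (σ ^ 2 / 2 * r) at h
    rw [e1] at h
    refine le_trans (le_of_eq ?_) (add_le_add_left h (σ ^ 2 / 2 * k * (p x - q x)))
    rw [e2, klFun_apply, klFun_apply]
    ring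
  have hint := integral_mono (hiF.add hikl) (hiK.add hik) hpt
  simp only [Pi.add_apply] at hint
  rw [integral_add hiF hikl, integral_add hiK hik, integral_const_mul, integral_const_mul,
    integral_const_mul, integral_sub hip hiq, integral_sub hm.integrable hμ.integrable,
    hm.integral, hμ.integral, ← hm.toReal_klDiv_eq, ← hμ.toReal_klDiv_eq,
    ← hm.integral_eq] at hint
  simp only [realEnergy]
  linarith

/-- The rate along the flow is bounded, hence square integrable. -/
theorem IsBirthDeathFlow.memLp_rate {m₀ : P d} {ρ₀ : E d → ℝ} {m : ℝ → P d}
    {ρ : ℝ → E d → ℝ} (hm : IsBirthDeathFlow dF U σ m₀ ρ₀ m ρ)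
    (hF : EnergyAssumption F dF d2F) (hσ : 0 < σ) (hU : Measurable U)
    (hUint : Integrable (fun x => Real.exp (-U x))) (hm₀ : InitialAssumption U m₀ ρ₀)
    {t : ℝ} (ht : 0 ≤ t) : MemLp (rate dF U σ (m t) (ρ t)) 2 (m t : Measure (E d)) := by
  obtain ⟨C, -, hC⟩ := hF.first_bounded
  obtain ⟨M, hM⟩ := hm.exists_ratio_bounds hF hσ hU hUint hm₀
  have hd := (hm.density t ht).hasRelDensity hU hUint
  refine MemLp.of_bound (((hF.first.measurable (m t)).add
    (hd.measurable.log.const_mul (σ ^ 2 / 2))).sub_const _).aestronglyMeasurable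
    (C + σ ^ 2 / 2 * M +
      σ ^ 2 / 2 * (klDiv (m t : Measure (E d)) (refMeasure U)).toReal)
    (ae_of_all _ fun x => ?_)
  obtain ⟨h1, h2⟩ := hM t ht x
  have hpos : 0 < ρ t x / refDensity U x := (Real.exp_pos _).trans_le h1
  rw [← Real.le_log_iff_exp_le hpos] at h1
  rw [← Real.log_le_iff_le_exp hpos] at h2
  have h3 := mul_le_mul_of_nonneg_left (abs_le.2 ⟨h1, h2⟩) (by positivity : 0 ≤ σ ^ 2 / 2)
  have h4 := hC (m t) x
  refine (norm_sub_le _ _).trans (add_le_add ((norm_add_le _ _).trans (add_le_add h4 ?_)) ?_)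
  · rwa [Real.norm_eq_abs, abs_mul, abs_of_nonneg (by positivity : 0 ≤ σ ^ 2 / 2)]
  · rw [Real.norm_eq_abs, abs_of_nonneg (by positivity)]

end Inequality

end FisherRao

theorem mainTheorem1 {d : ℕ}
    (F : FisherRao.P d → ℝ) (dF : FisherRao.P d → FisherRao.E d → ℝ)
    (d2F : FisherRao.P d → FisherRao.E d → FisherRao.E d → ℝ)
    (U : FisherRao.E d → ℝ) (σ : ℝ)
    (m₀ : FisherRao.P d) (ρ₀ : FisherRao.E d → ℝ)
    (m : ℝ → FisherRao.P d) (ρ : ℝ → FisherRao.E d → ℝ)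
    (hσ : 0 < σ)
    (hU : Measurable U)
    (hUint : Integrable (fun x => Real.exp (-U x)))
    (hF : FisherRao.EnergyAssumption F dF d2F)
    (hm₀ : FisherRao.InitialAssumption U m₀ ρ₀)
    (hm : FisherRao.IsBirthDeathFlow dF U σ m₀ ρ₀ m ρ) :
    -- the minimizer exists
    (∃ mstar, FisherRao.IsMinimizer F U σ mstar) ∧
    ∀ mstar, FisherRao.IsMinimizer F U σ mstar →
      -- it has the Gibbs density, which is the version used below
      FisherRao.HasDensity mstar (FisherRao.gibbsDensity dF U σ mstar) ∧
      FisherRao.energy F U σ mstar ≠ ⊤ ∧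
      -- bounds on the density ratio that are uniform in time exist
      (∃ r > 0, ∃ R > 1, ∀ t, 0 ≤ t → ∀ x,
        r ≤ ρ t x / FisherRao.gibbsDensity dF U σ mstar x ∧
          ρ t x / FisherRao.gibbsDensity dF U σ mstar x ≤ R) ∧
      -- every such pair of bounds gives the inequality
      ∀ r R : ℝ, 0 < r →
        (∀ t, 0 ≤ t → ∀ x,
          r ≤ ρ t x / FisherRao.gibbsDensity dF U σ mstar x ∧
            ρ t x / FisherRao.gibbsDensity dF U σ mstar x ≤ R) →
        ∀ t, 0 ≤ t →
          FisherRao.energy F U σ (m t) ≠ ⊤ ∧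
          MemLp (FisherRao.rate dF U σ (m t) (ρ t)) 2 (m t : Measure (FisherRao.E d)) ∧
          FisherRao.energy F U σ (m t) - FisherRao.energy F U σ mstar ≤
            ((4 * R / (σ ^ 2 * r) *
              ∫ x, (FisherRao.rate dF U σ (m t) (ρ t) x) ^ 2
                ∂(m t : Measure (FisherRao.E d)) : ℝ) : EReal) := by
  have := FisherRao.isProbabilityMeasure_refMeasure hUint
  refine ⟨hF.exists_isMinimizer hσ hUint, fun mstar hmin => ?_⟩
  have hstar := hmin.hasDensity_gibbsDensity hF hσ hU hUint
  have hkstar := ((FisherRao.isMinimizer_iff hσ hUint).1 hmin).1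
  refine ⟨hstar, ?_, hm.exists_ratio_gibbsDensity_bounds hF hσ hU hUint hm₀ mstar, ?_⟩
  · rw [FisherRao.energy_eq_coe hkstar]
    exact EReal.coe_ne_top _
  intro r R hr hratio t ht
  have hkm := hm.kl_ne_top t ht
  have hL2 := hm.memLp_rate hF hσ hU hUint hm₀ ht
  refine ⟨by rw [FisherRao.energy_eq_coe hkm]; exact EReal.coe_ne_top _, hL2, ?_⟩
  rw [FisherRao.energy_eq_coe hkm, FisherRao.energy_eq_coe hkstar, ← EReal.coe_sub,
    EReal.coe_le_coe_iff]
  have hp := (hm.density t ht).hasRelDensity hU hUint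
  have hq := hstar.hasRelDensity hU hUint
  have hgpos : ∀ x, 0 < FisherRao.gibbsDensity dF U σ mstar x := fun x => by
    obtain ⟨c, hc, c', -, h⟩ := FisherRao.exists_gibbsDensity_bounds (σ := σ) hF hU hUint mstar
    exact (mul_pos hc (FisherRao.refDensity_pos hUint x)).trans_le (h x).1
  have hπ := FisherRao.refDensity_pos hUint
  obtain ⟨hr1, hgap⟩ := hF.realEnergy_sub_le hσ hUint hp hq
    (fun x => div_pos (hm.density_pos hF hσ hUint hm₀ ht x) (hπ x)) hkm hkstar hL2 hr fun x => by
      rw [← mul_div_assoc]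
      exact div_le_div_of_nonneg_right ((le_div_iff₀ (hgpos x)).1 (hratio t ht x).1) (hπ x).le
  -- both densities have mass `1`, so the upper bound of their ratio is at least `1`
  have hR1 : 1 ≤ R := by
    have h := integral_mono hp.integrable (hq.integrable.const_mul R) fun x => by
      change ρ t x / FisherRao.refDensity U x ≤
        R * (FisherRao.gibbsDensity dF U σ mstar x / FisherRao.refDensity U x)
      rw [← mul_div_assoc]
      exact div_le_div_of_nonneg_right ((div_le_iff₀ (hgpos x)).1 (hratio t ht x).2) (hπ x).le
    rwa [integral_const_mul, hp.integral, hq.integral, mul_one] at h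
  refine hgap.trans (mul_le_mul_of_nonneg_right ?_ (integral_nonneg fun x => sq_nonneg _))
  exact div_le_div_of_nonneg_right (by linarith) (by positivity)
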